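/- **Morse's Lemma over a complete DVR.** Let $V$ be a complete discrete valuation ring with uniformizer $\pi$ and residue field $\kappa$, where $\kappa$ has characteristic $\neq 2$ and is quadratically closed (every element of $\kappa$ is a square). Let $n\ge 0$, let $V[[\underline{x}]]=V[[x_1,\dots,x_n]]$ with maximal ideal $\mathfrak m_V=\langle \pi,x_1,\dots,x_n\rangle$, and let $f\in\mathfrak m_V^2$. *Notation.* Let $V[[\underline{x},y]]=V[[x_1,\dots,x_n,y]]$ have maximal ideal $\mathfrak n_V=\langle\pi,x_1,\dots,x_n,y\rangle$. - For $g=\sum_\alpha a_\alpha\underline{x}^\alpha\in V[[\underline{x}]]$, write each nonzero $a_\alpha$ uniquely as $u_\alpha\pi^{n_\alpha}$ with $u_\alpha$ a unit, and put $\tilde g=\sum_{a_\alpha\ne 0}u_\alpha y^{n_\alpha}\underline{x}^\alpha\in V[[\underline{x},y]]$. - For $g,h\in V[[\underline{x}]]$, $g\sim h$ means that $V[[\underline{x},y]]/\langle\tilde g\rangle\cong V[[\underline{x},y]]/\langle\tilde h\rangle$ as $V$-algebras. - $J(\tilde f)=\langle\partial_{x_1}\tilde f,\dots,\partial_{x_n}\tilde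 f,\partial_y\tilde f\rangle$ and $A=V[[\underline{x},y]]/(\langle\tilde f\rangle+J(\tilde f))$. - An ideal $J\subseteq I$ is a reduction of $I$ if $JI^N=I^{N+1}$ for some $N\ge 0$; it is a minimal reduction if no ideal strictly contained in $J$ is a reduction of $I$. - If $\dim A=1$, then $\tau_V(f)=\operatorname{length}_{V[[\underline{x},y]]}\bigl(V[[\underline{x},y]]/(J(\tilde f)+\langle\tilde f,a\rangle)\bigr)$ for some $a\in V[[\underline{x},y]]$ whose image in $A$ generates a minimal reduction of the maximal ideal of $A$; if $\dim A\neq 1$, then $\tau_V(f)=\infty$. - $\mathfrak a_3=\langle\underline{x},y\rangle^3+\pi\langle\underline{x},y\rangle^2+\pi^2\langle\underline{x},y\rangle\subset V[[\underline{x},y]]$. We write $\mathrm{rk}(f)=k$, where $0\le k\le n$, if there are a $V$-algebra automorphism $\varphi$ of $V[[\underline{x},y]]$ and some $g\in\mathfrak a_3\cap V[[x_{k+1},\dots,x_n]]$ with $\varphi(\tilde f)=y^2+x_1^2+\dots+x_k^2+g$. Then the following are equivalent: 1. $\tau_V(f)=1$ (for some choice of $a$ as above; equivalently, such an $a$ exists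 and $\tau_V(f)=1$ for every such choice); 2. $\mathrm{rk}(f)=n$; 3. $f\sim\pi^2+x_1^2+\cdots+x_n^2$. -/

import Mathlib

namespace MorseDVR

/-- The ring `V[[x₁, …, xₙ, y]]`: the variable `y` is indexed by `none`,
and `xᵢ` is indexed by `some i`. -/
abbrev PowXY (n : ℕ) (V : Type*) : Type _ := MvPowerSeries (Option (Fin n)) V

section Tilde

variable {V : Type*} [CommRing V]

open Classical in
/-- `unitCoeff π a m = u` if `a = u * π ^ m` with `u` a unit, and `0` if there is no such unit.
When `π` is a uniformizer of a discrete valuation ring and `a ≠ 0`, there is exactly one `m` for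
which such a unit exists, and then the unit is unique; for `a = 0` the value is always `0`. -/
noncomputable def unitCoeff (π a : V) (m : ℕ) : V :=
  if h : ∃ u : Vˣ, a = u * π ^ m then ((h.choose : Vˣ) : V) else 0

/-- The lift `f̃ = ∑ u_α y ^ n_α x ^ α` of `f = ∑ u_α π ^ n_α x ^ α`: its coefficient at
`y ^ m x ^ α` is `u_α` if `m = n_α`, and `0` otherwise. -/
noncomputable def tilde {n : ℕ} (π : V) (f : MvPowerSeries (Fin n) V) : PowXY n V :=
  fun e => unitCoeff π (MvPowerSeries.coeff e.some f) (e none)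

end Tilde

section Equivalence

variable {V : Type*} [CommRing V]

/-- Contact equivalence: the quotients by `⟨f⟩` and `⟨g⟩` are isomorphic `V`-algebras. -/
def ContactEquiv {σ : Type*} (f g : MvPowerSeries σ V) : Prop :=
  Nonempty ((MvPowerSeries σ V ⧸ Ideal.span {f}) ≃ₐ[V] (MvPowerSeries σ V ⧸ Ideal.span {g}))

/-- Right equivalence: some `V`-algebra automorphism maps `f` to `g`. -/
def RightEquiv {σ : Type*} (f g : MvPowerSeries σ V) : Prop :=
  ∃ φ : MvPowerSeries σ V ≃ₐ[V] MvPowerSeries σ V, φ f = g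

/-- The equivalence `f ∼ g` on `V[[x]]`: the lifts of `f` and `g` are contact equivalent. -/
def Equivalent {n : ℕ} (π : V) (f g : MvPowerSeries (Fin n) V) : Prop :=
  ContactEquiv (tilde π f) (tilde π g)

end Equivalence

section Tjurina

/-- `J` is a reduction of `I`: `J ⊆ I` and `J * I ^ N = I ^ (N + 1)` for some `N`. -/
def IsReduction {A : Type*} [CommRing A] (J I : Ideal A) : Prop :=
  J ≤ I ∧ ∃ N : ℕ, J * I ^ N = I ^ (N + 1)

/-- `J` is a minimal reduction of `I`: a reduction that contains no strictly smaller one. -/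
def IsMinimalReduction {A : Type*} [CommRing A] (J I : Ideal A) : Prop :=
  IsReduction J I ∧ ∀ J₁ : Ideal A, J₁ < J → ¬ IsReduction J₁ I

variable {V : Type*} [CommRing V]

/-- The Jacobian ideal, generated by the partial derivatives with respect to all variables. -/
noncomputable def jacobianIdeal {σ : Type*} (F : MvPowerSeries σ V) : Ideal (MvPowerSeries σ V) :=
  Ideal.span (Set.range fun i : σ => MvPowerSeries.pderiv V i F)

/-- The ideal `⟨f̃⟩ + J(f̃)` of `V[[x, y]]`. -/
noncomputable def tjurinaIdeal {n : ℕ} (π : V) (f : MvPowerSeries (Fin n) V) :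
    Ideal (PowXY n V) :=
  Ideal.span {tilde π f} ⊔ jacobianIdeal (tilde π f)

/-- `a` is an admissible cut for `f`: modulo `I = ⟨f̃⟩ + J(f̃)` it generates a minimal reduction of
the maximal ideal of `V[[x, y]] ⧸ I`, which is the image of the maximal ideal of `V[[x, y]]`. -/
def IsAdmissibleCut [IsLocalRing V] {n : ℕ} (π : V) (f : MvPowerSeries (Fin n) V)
    (a : PowXY n V) : Prop :=
  IsMinimalReduction (Ideal.span {Ideal.Quotient.mk (tjurinaIdeal π f) a})
    ((IsLocalRing.maximalIdeal (PowXY n V)).map (Ideal.Quotient.mk (tjurinaIdeal π f)))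

/-- `t` is the Tjurina number `τ_V(f)`, computed with some admissible cut `a`: if
`V[[x, y]] ⧸ (⟨f̃⟩ + J(f̃))` is one-dimensional, then `t` is the length over `V[[x, y]]` of
`V[[x, y]] ⧸ (J(f̃) + ⟨f̃, a⟩)`; otherwise `t = ∞`. -/
def IsTjurinaNumber [IsLocalRing V] {n : ℕ} (π : V) (f : MvPowerSeries (Fin n) V)
    (t : ℕ∞) : Prop :=
  (ringKrullDim (PowXY n V ⧸ tjurinaIdeal π f) = 1 ∧
    ∃ a : PowXY n V, IsAdmissibleCut π f a ∧
      t = Module.length (PowXY n V) (PowXY n V ⧸ (tjurinaIdeal π f ⊔ Ideal.span {a}))) ∨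
  (ringKrullDim (PowXY n V ⧸ tjurinaIdeal π f) ≠ 1 ∧ t = ⊤)

end Tjurina

section Rank

variable {V : Type*} [CommRing V]

/-- The ideal `𝔞_r = ∑_{i < r} ⟨π ^ i⟩ * ⟨x₁, …, xₙ, y⟩ ^ (r - i)` of `V[[x, y]]`. -/
noncomputable def residualIdeal (n : ℕ) (π : V) (r : ℕ) : Ideal (PowXY n V) :=
  ∑ i ∈ Finset.range r, Ideal.span {(MvPowerSeries.C (π ^ i) : PowXY n V)} *
    Ideal.span (Set.range fun s : Option (Fin n) => (MvPowerSeries.X s : PowXY n V)) ^ (r - i)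

/-- `g` lies in `V[[x_{k+1}, …, xₙ]]`: only the variables `x_{k+1}, …, xₙ` occur in it
(with indices in `Fin n`, these are the `xᵢ` with `k ≤ i`). -/
def OnlyLastVars {n : ℕ} (k : ℕ) (g : PowXY n V) : Prop :=
  ∀ e : Option (Fin n) →₀ ℕ, MvPowerSeries.coeff e g ≠ 0 →
    e none = 0 ∧ ∀ i : Fin n, (i : ℕ) < k → e (some i) = 0

/-- `rk(f) = k`: `0 ≤ k ≤ n`, and `f̃` is right equivalent to
`y² + x₁² + ⋯ + x_k² + g` for some `g ∈ 𝔞₃ ∩ V[[x_{k+1}, …, xₙ]]`. -/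
def HasRank {n : ℕ} (π : V) (f : MvPowerSeries (Fin n) V) (k : ℕ) : Prop :=
  k ≤ n ∧ ∃ g : PowXY n V, g ∈ residualIdeal n π 3 ∧ OnlyLastVars k g ∧
    RightEquiv (tilde π f)
      ((MvPowerSeries.X none : PowXY n V) ^ 2 +
        (∑ i ∈ Finset.univ.filter (fun i : Fin n => (i : ℕ) < k),
          (MvPowerSeries.X (some i) : PowXY n V) ^ 2) + g)

end Rank

end MorseDVR

namespace MorseDVR

/-! ### Linear and quadratic parts of power series. -/

section LinearPart

open MvPowerSeries Finsupp

variable {σ V : Type*} [CommRing V]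

/-! Every condition is compared with one criterion: the Hessian of F = `tilde π f` at the origin is
invertible over `V`. Since f lies in the square of the maximal ideal, F has no terms of degree below
2 in (x, y).

If the Hessian is invertible, write F = xᵀAx with A symmetric and A(0) half the Hessian. Units of
`V[[x, y]]` are squares, by Hensel's lemma and a formal square root, so A = SᵀS and Sx is a new
coordinate system in which F is a sum of squares (`exists_algEquiv_sum_sq`). Moreover the partials
generate ⟨x, y⟩, so the Tjurina quotient is `V`, whose maximal ideal has itself as its only
reduction; hence τ = 1 for every cut (`isTjurinaNumber_iff_eq_one`).

Conversely, τ = 1 makes the partials, F and the cut generate the maximal ideal. Contact equivalence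
to a sum of squares gives w_s with ∑ w_s² ∈ ⟨F⟩. In both cases, comparing low-order coefficients
over the residue field shows that the Hessian is invertible (`isUnit_det_linearPart`). -/

theorem coeff_single_mul (s : σ) (p q : MvPowerSeries σ V) :
    coeff (single s 1) (p * q) =
      constantCoeff p * coeff (single s 1) q + coeff (single s 1) p * constantCoeff q := by
  classical
  rw [coeff_mul, antidiagonal_single, Finset.sum_map, Finset.Nat.antidiagonal_succ]
  simp

theorem constantCoeff_pderiv (s : σ) (p : MvPowerSeries σ V) :
    constantCoeff (pderiv V s p) = coeff (single s 1) p := by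
  rw [← coeff_zero_eq_constantCoeff_apply, coeff_pderiv]
  simp

theorem coeff_single_X [DecidableEq σ] (s t : σ) :
    coeff (single s 1) (X t : MvPowerSeries σ V) = if t = s then 1 else 0 := by
  rw [coeff_X]
  exact if_congr ((Finsupp.single_left_injective one_ne_zero).eq_iff.trans eq_comm) rfl rfl

/-- The matrix of linear coefficients of a family of power series. -/
noncomputable def linearPart (w : σ → MvPowerSeries σ V) : Matrix σ σ V :=
  Matrix.of fun i j => coeff (single j 1) (w i)

/-- The Hessian matrix at the origin. -/
noncomputable def hessian (F : MvPowerSeries σ V) : Matrix σ σ V :=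
  linearPart fun i => pderiv V i F

theorem hessian_apply (F : MvPowerSeries σ V) (i j : σ) :
    hessian F i j = coeff (single j 1) (pderiv V i F) := rfl

theorem hessian_mul {h F : MvPowerSeries σ V} (h0 : constantCoeff F = 0)
    (h1 : ∀ s, coeff (single s 1) F = 0) :
    hessian (h * F) = constantCoeff h • hessian F := by
  ext i j
  rw [Matrix.smul_apply, hessian_apply, hessian_apply, Derivation.leibniz]
  simp [coeff_single_mul, h0, h1, constantCoeff_pderiv]

variable [Fintype σ]

/-- Each nonconstant monomial is assigned to one variable dividing it, so nothing cancels. The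
support condition transfers lower bounds on the order from `p` to the `q s`. -/
theorem exists_eq_sum_X_mul {p : MvPowerSeries σ V} (hp : constantCoeff p = 0) :
    ∃ q : σ → MvPowerSeries σ V, p = ∑ s, X s * q s ∧
      ∀ s e, coeff e (q s) ≠ 0 → coeff (e + single s 1) p ≠ 0 := by
  classical
  have hex : ∀ e : σ →₀ ℕ, e ≠ 0 → ∃ s, e s ≠ 0 := fun e he => Finsupp.ne_iff.mp he
  choose c hc using hex
  let q : σ → MvPowerSeries σ V := fun s e =>
    if ∃ h : e + single s 1 ≠ 0, c _ h = s then coeff (e + single s 1) p else 0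
  have hq : ∀ s e, coeff e (q s) =
    if ∃ h : e + single s 1 ≠ 0, c _ h = s then coeff (e + single s 1) p else 0 := fun _ _ => rfl
  refine ⟨q, ?_, fun s e h => ?_⟩
  swap
  · rw [hq] at h
    split_ifs at h
    · exact h
    · exact absurd rfl h
  ext e
  simp only [map_sum, X, coeff_monomial_mul, single_le_iff, one_mul]
  by_cases he : e = 0
  · subst he
    simp [hp]
  · rw [Finset.sum_eq_single (c e he)]
    · have h1 : 1 ≤ e (c e he) := Nat.one_le_iff_ne_zero.mpr (hc e he)
      rw [if_pos h1, hq, tsub_add_cancel_of_le (single_le_iff.mpr h1), if_pos ⟨he, rfl⟩]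
    · intro s _ hs
      split_ifs with h1
      · rw [hq, tsub_add_cancel_of_le (single_le_iff.mpr h1), if_neg]
        rintro ⟨_, h⟩
        exact hs h.symm
      · rfl
    · simp

theorem hessian_sum_sq (w : σ → MvPowerSeries σ V) (i j : σ) :
    hessian (∑ s, w s ^ 2) i j = 2 * ((linearPart w).transpose * linearPart w) i j +
      2 * ∑ s, constantCoeff (w s) * hessian (w s) i j := by
  simp only [hessian_apply, map_sum, pow_two, Derivation.leibniz, smul_eq_mul, map_add,
    coeff_single_mul, constantCoeff_pderiv, Matrix.mul_apply, Matrix.transpose_apply, linearPart,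
    Matrix.of_apply, Finset.mul_sum, ← Finset.sum_add_distrib]
  refine Finset.sum_congr rfl fun s _ => ?_
  ring

variable [DecidableEq σ]

theorem coeff_single_sum_X_mul (q : σ → MvPowerSeries σ V) (s : σ) :
    coeff (single s 1) (∑ t, X t * q t) = constantCoeff (q s) := by
  rw [map_sum, Finset.sum_eq_single s]
  · simp [coeff_single_mul]
  · intro t _ hts
    simp [coeff_single_mul, coeff_single_X, hts]
  · simp

/-- Factor out a variable twice, then average the coefficient matrix with its transpose. -/
theorem exists_eq_quadratic [Invertible (2 : V)] {F : MvPowerSeries σ V}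
    (h0 : constantCoeff F = 0) (h1 : ∀ s, coeff (single s 1) F = 0) :
    ∃ A : Matrix σ σ (MvPowerSeries σ V), A.IsSymm ∧ F = ∑ i, ∑ j, X i * A i j * X j ∧
      A.map constantCoeff = (⅟2 : V) • hessian F := by
  obtain ⟨g, hg, -⟩ := exists_eq_sum_X_mul h0
  have hg0 : ∀ s, constantCoeff (g s) = 0 := fun s => by
    rw [← coeff_single_sum_X_mul, ← hg, h1]
  choose B hB _ using fun s => exists_eq_sum_X_mul (hg0 s)
  have h2 : (C (⅟2 : V) : MvPowerSeries σ V) * 2 = 1 := by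
    rw [show (2 : MvPowerSeries σ V) = C 2 from (map_ofNat C 2).symm, ← map_mul]
    simp
  refine ⟨Matrix.of fun i j => C ⅟2 * (B i j + B j i), ?_, ?_, ?_⟩
  · refine Matrix.IsSymm.ext fun i j => ?_
    simp only [Matrix.of_apply, add_comm]
  · have e1 : F = ∑ i, ∑ j, X i * (X j * B i j) := by
      conv_lhs => rw [hg]
      refine Finset.sum_congr rfl fun i _ => ?_
      rw [← Finset.mul_sum, ← hB]
    have e2 : F = ∑ i, ∑ j, X i * (X j * B j i) := by
      rw [e1, Finset.sum_comm]
      exact Finset.sum_congr rfl fun i _ => Finset.sum_congr rfl fun j _ => by ring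
    calc F = C (⅟2 : V) * 2 * F := by rw [h2, one_mul]
      _ = C (⅟2 : V) * (F + F) := by ring
      _ = _ := by
        nth_rewrite 1 [e1]
        nth_rewrite 1 [e2]
        simp only [← Finset.sum_add_distrib, Finset.mul_sum, Matrix.of_apply]
        exact Finset.sum_congr rfl fun i _ => Finset.sum_congr rfl fun j _ => by ring
  · ext i j
    have : hessian F i j = constantCoeff (B i j) + constantCoeff (B j i) := by
      have hX : ∀ t, pderiv V i (X t : MvPowerSeries σ V) = if t = i then 1 else 0 := fun t => by
        rw [pderiv_X, Pi.single_apply]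
      have hg1 : ∀ s t, coeff (single t 1) (g s) = constantCoeff (B s t) := fun s t => by
        rw [hB s, coeff_single_sum_X_mul]
      rw [hessian_apply, hg]
      simp only [map_sum, Derivation.leibniz, smul_eq_mul, map_add, Finset.sum_add_distrib]
      rw [← map_sum, coeff_single_sum_X_mul, constantCoeff_pderiv, hg1, add_comm]
      simp [hX, hg1, apply_ite (coeff (single j 1))]
    simp [this]

/-- Over the residue field the constant terms of `w` and the linear terms of `r` vanish, so the
constant terms of `c` form a left inverse of the linear part. -/
theorem isUnit_det_linearPart [IsLocalRing V] (w : σ → MvPowerSeries σ V)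
    (hw : ∀ s, constantCoeff (w s) ∈ IsLocalRing.maximalIdeal V)
    (h : ∀ s, ∃ (c : σ → MvPowerSeries σ V) (r : MvPowerSeries σ V), X s = ∑ i, c i * w i + r ∧
      ∀ j, coeff (single j 1) r ∈ IsLocalRing.maximalIdeal V) :
    IsUnit (linearPart w).det := by
  choose c r hcr hr using h
  let ρ := IsLocalRing.residue V
  have hone : (Matrix.of fun s i => ρ (constantCoeff (c s i))) * (linearPart w).map ρ = 1 := by
    ext s j
    have := congrArg (fun p => ρ (coeff (single j 1) p)) (hcr s)
    simp only [map_add, map_sum, coeff_single_mul, map_mul] at this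
    rw [(IsLocalRing.residue_eq_zero_iff _).mpr (hr s j)] at this
    have hw' : ∀ i, ρ (constantCoeff (w i)) = 0 := fun i =>
      (IsLocalRing.residue_eq_zero_iff _).mpr (hw i)
    simp only [hw', mul_zero, add_zero] at this
    rw [Matrix.mul_apply]
    simp only [Matrix.of_apply, Matrix.map_apply, linearPart]
    rw [← this, coeff_single_X, Matrix.one_apply]
    split_ifs <;> simp
  rw [← isUnit_map_iff ρ, RingHom.map_det]
  exact Matrix.isUnit_det_of_left_inverse hone

end LinearPart

/-! ### Square roots of units. -/

section SquareRoots

open MvPowerSeries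

theorem exists_sq_eq_of_constantCoeff_eq_one {σ V : Type*} [CommRing V] [Invertible (2 : V)]
    [Finite σ] {p : MvPowerSeries σ V} (hp : constantCoeff p = 1) : ∃ q, q ^ 2 = p := by
  have h4 : (⅟2 : V) * ⅟2 * 4 = 1 := by
    rw [show (4 : V) = 2 * 2 by norm_num, mul_assoc, invOf_mul_cancel_left, invOf_mul_self]
  have hC : (C (⅟2 * ⅟2 : V) : MvPowerSeries σ V) * 4 = 1 := by
    rw [show (4 : MvPowerSeries σ V) = C 4 from (map_ofNat C 4).symm, ← map_mul, h4, map_one]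
  let t : MvPowerSeries σ V := C (⅟2 * ⅟2) * (1 - p)
  have ht : constantCoeff t = 0 := by simp [t, hp]
  have hs : PowerSeries.HasSubst t := PowerSeries.HasSubst.of_constantCoeff_zero ht
  -- The Catalan series has integer coefficients and satisfies c = 1 + tc². With 4t = 1 - p this
  -- gives (1 - 2tc)² = 1 - 4t = p, so only 2 has to be inverted.
  let c : MvPowerSeries σ V :=
    PowerSeries.subst t (PowerSeries.map (Nat.castRingHom V) PowerSeries.catalanSeries)
  have hc : c ^ 2 * t + 1 = c := by
    have := congrArg (fun s => PowerSeries.substAlgHom (S := V) hs (PowerSeries.map (Nat.castRingHom V) s))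
      PowerSeries.catalanSeries_sq_mul_X_add_one
    simp only [map_add, map_mul, map_pow, map_one, PowerSeries.map_X] at this
    simpa only [PowerSeries.coe_substAlgHom, PowerSeries.subst_X hs] using this
  refine ⟨1 - 2 * t * c, ?_⟩
  have h4t : 4 * t = 1 - p := by
    rw [show 4 * t = (C (⅟2 * ⅟2) * 4) * (1 - p) by ring, hC, one_mul]
  linear_combination (-1 : MvPowerSeries σ V) * h4t + 4 * t * hc

theorem isSquare_of_isUnit_of_isSquare_residueField {V : Type*} [CommRing V]
    [HenselianLocalRing V] (h2 : IsUnit (2 : V))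
    (hquad : ∀ c : IsLocalRing.ResidueField V, IsSquare c) {u : V} (hu : IsUnit u) :
    IsSquare u := by
  obtain ⟨d, hd⟩ := hquad (IsLocalRing.residue V u)
  obtain ⟨d, rfl⟩ := IsLocalRing.residue_surjective d
  have hdu : IsUnit d := by
    have : IsUnit (IsLocalRing.residue V d * IsLocalRing.residue V d) :=
      hd ▸ hu.map (IsLocalRing.residue V)
    exact (isUnit_map_iff (IsLocalRing.residue V) d).mp (isUnit_of_mul_isUnit_left this)
  obtain ⟨a, ha, -⟩ := HenselianLocalRing.is_henselian (Polynomial.X ^ 2 - Polynomial.C u)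
    (Polynomial.monic_X_pow_sub_C u two_ne_zero) d
    (by
      rw [← IsLocalRing.residue_eq_zero_iff]
      simp [hd, pow_two])
    (by simpa [one_add_one_eq_two] using h2.mul hdu)
  refine ⟨a, ?_⟩
  rw [Polynomial.IsRoot.def] at ha
  simp only [Polynomial.eval_sub, Polynomial.eval_pow, Polynomial.eval_X, Polynomial.eval_C] at ha
  linear_combination -ha

theorem isSquare_of_isUnit {σ V : Type*} [Finite σ] [CommRing V] [Invertible (2 : V)]
    (hV : ∀ u : V, IsUnit u → IsSquare u) {p : MvPowerSeries σ V} (hp : IsUnit p) :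
    IsSquare p := by
  have hp0 := isUnit_iff_constantCoeff.mp hp
  obtain ⟨d, hd⟩ := hV _ hp0
  obtain ⟨v, hv⟩ := hp0
  obtain ⟨q, hq⟩ := exists_sq_eq_of_constantCoeff_eq_one (p := C (↑v⁻¹ : V) * p) (by simp [← hv])
  refine ⟨C d * q, ?_⟩
  have : (C (v : V) : MvPowerSeries σ V) * C (↑v⁻¹ : V) = 1 := by rw [← map_mul]; simp
  rw [mul_mul_mul_comm, ← map_mul, ← hd, ← pow_two, hq, ← mul_assoc, ← hv, this, one_mul]

end SquareRoots

/-! ### Diagonalizing symmetric matrices over local rings. -/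

section SymmetricMatrices

open Matrix

variable {R : Type*} [CommRing R] [IsLocalRing R]

theorem exists_isUnit_apply {ι : Type*} [Fintype ι] [DecidableEq ι] {h : Matrix ι ι R}
    (hdet : IsUnit h.det) (i : ι) : ∃ j, IsUnit (h i j) := by
  by_contra! hne
  rw [← isUnit_map_iff (IsLocalRing.residue R), RingHom.map_det,
    det_eq_zero_of_row_eq_zero i fun j => ?_] at hdet
  · exact not_isUnit_zero hdet
  · exact (IsLocalRing.residue_eq_zero_iff _).mpr (hne j)

theorem exists_congruent_isUnit_apply {ι : Type*} [Fintype ι] [DecidableEq ι] (h2 : IsUnit (2 : R))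
    {h : Matrix ι ι R} (hsymm : h.IsSymm) (hdet : IsUnit h.det) (i : ι) :
    ∃ P : Matrix ι ι R, IsUnit P.det ∧ ∃ k, IsUnit ((Pᵀ * h * P) k k) := by
  by_cases hd : ∃ k, IsUnit (h k k)
  · obtain ⟨k, hk⟩ := hd
    exact ⟨1, by simp, k, by simpa using hk⟩
  push Not at hd
  obtain ⟨j, hj⟩ := exists_isUnit_apply hdet i
  have hij : i ≠ j := by
    rintro rfl
    exact hd _ hj
  -- Replacing e_i by e_i + e_j makes the diagonal entry 2h_ij + h_ii + h_jj, a unit plus nonunits.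
  refine ⟨transvection j i 1, ?_, i, ?_⟩
  · rw [det_transvection_of_ne _ _ hij.symm]
    exact isUnit_one
  · have e : ((transvection j i (1 : R))ᵀ * h * transvection j i (1 : R) : Matrix ι ι R) i i =
        2 * h i j + (h i i + h j j) := by
      have hs : h j i = h i j := hsymm.apply i j
      rw [mul_transvection_apply_same]
      simp only [transvection, transpose_add, transpose_one, add_mul, one_mul, Matrix.add_apply]
      simp [hs]
      ring
    rw [e]
    by_contra hu
    refine (IsLocalRing.mem_maximalIdeal _).not.mpr (not_not.mpr (h2.mul hj)) ?_
    have := Ideal.sub_mem _ ((IsLocalRing.mem_maximalIdeal _).mpr hu)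
      (Ideal.add_mem _ ((IsLocalRing.mem_maximalIdeal _).mpr (hd i))
        ((IsLocalRing.mem_maximalIdeal _).mpr (hd j)))
    simpa using this

/-- Over a local ring in which `2` is invertible and units are squares, every unimodular symmetric
matrix is congruent to the identity. -/
theorem exists_transpose_mul_self (h2 : IsUnit (2 : R)) (hsq : ∀ u : R, IsUnit u → IsSquare u)
    (n : ℕ) : ∀ {ι : Type*} [Fintype ι] [DecidableEq ι], Fintype.card ι = n →
      ∀ h : Matrix ι ι R, h.IsSymm → IsUnit h.det → ∃ S : Matrix ι ι R, h = Sᵀ * S := by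
  induction n with
  | zero =>
    intro ι _ _ hι h _ _
    have := Fintype.card_eq_zero_iff.mp hι
    exact ⟨0, Subsingleton.elim _ _⟩
  | succ n ih =>
    intro ι _ _ hι h hsymm hdet
    obtain ⟨i⟩ : Nonempty ι := Fintype.card_pos_iff.mp (by omega)
    obtain ⟨P, hP, k, hk⟩ := exists_congruent_isUnit_apply h2 hsymm hdet i
    suffices H : ∃ S : Matrix ι ι R, Pᵀ * h * P = Sᵀ * S by
      obtain ⟨S, hS⟩ := H
      refine ⟨S * P⁻¹, ?_⟩
      have hPi := mul_nonsing_inv P hP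
      rw [transpose_mul, Matrix.mul_assoc, ← Matrix.mul_assoc Sᵀ, ← hS]
      have hPi' : (P⁻¹)ᵀ * Pᵀ = 1 := by rw [← transpose_mul, hPi, transpose_one]
      calc h = ((P⁻¹)ᵀ * Pᵀ) * h * (P * P⁻¹) := by rw [hPi, hPi', Matrix.one_mul, Matrix.mul_one]
        _ = _ := by simp only [Matrix.mul_assoc]
    have hsymm' : (Pᵀ * h * P).IsSymm := by
      rw [Matrix.IsSymm, transpose_mul, transpose_mul, transpose_transpose, hsymm.eq,
        Matrix.mul_assoc]
    have hdet' : IsUnit (Pᵀ * h * P).det := by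
      rw [det_mul, det_mul, det_transpose]
      exact (hP.mul hdet).mul hP
    generalize Pᵀ * h * P = g at hk hsymm' hdet'
    let e := Equiv.sumCompl fun j => j = k
    let g' := g.submatrix e e
    suffices H : ∃ S, g' = Sᵀ * S by
      obtain ⟨S, hS⟩ := H
      refine ⟨S.submatrix e.symm e.symm, ?_⟩
      rw [transpose_submatrix, submatrix_mul_equiv, ← hS]
      simp [g']
    obtain ⟨c, hc⟩ := hsq _ hk
    have hcu : IsUnit c := isUnit_of_mul_isUnit_left (hc ▸ hk)
    obtain ⟨v, rfl⟩ := hcu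
    let s : Matrix {j // j = k} {j // j = k} R := of fun _ _ => (v : R)
    let b : Matrix {j // j = k} {j // ¬ j = k} R := of fun _ j => (↑v⁻¹ : R) * g k j
    let D : Matrix {j // ¬ j = k} {j // ¬ j = k} R := of fun i j => g i j
    -- Completing the square at the pivot v² leaves the Schur complement `D - bᵀ * b` for the
    -- induction.
    have hg' : g' = (fromBlocks s b 0 1)ᵀ * fromBlocks 1 0 0 (D - bᵀ * b) *
        fromBlocks s b 0 1 := by
      have : g' = fromBlocks (sᵀ * s) (sᵀ * b) (bᵀ * s) D := by
        ext (⟨i, rfl⟩ | i) (⟨j, rfl⟩ | j)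
        · simp [g', e, s, Matrix.mul_apply, hc]
        · simp [g', e, s, b, Matrix.mul_apply]
        · simp [g', e, s, b, Matrix.mul_apply, mul_comm _ (v : R), hsymm'.apply]
        · simp [g', e, D]
      rw [this]
      simp [fromBlocks_multiply, fromBlocks_transpose]
    have hE : (D - bᵀ * b).IsSymm := by
      refine IsSymm.sub (IsSymm.ext fun i j => hsymm'.apply _ _) ?_
      rw [IsSymm, transpose_mul, transpose_transpose]
    have hEdet : IsUnit (D - bᵀ * b).det := by
      have hdg : IsUnit g'.det := by
        rw [det_submatrix_equiv_self]
        exact hdet'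
      rw [hg', det_mul, det_mul, det_fromBlocks_zero₂₁, det_one, one_mul] at hdg
      exact isUnit_of_mul_isUnit_right (isUnit_of_mul_isUnit_left hdg)
    have hcard : Fintype.card {j // ¬ j = k} = n := by
      rw [Fintype.card_subtype_compl, Fintype.card_subtype_eq, hι]
      rfl
    obtain ⟨S, hS⟩ := ih hcard _ hE hEdet
    refine ⟨fromBlocks 1 0 0 S * fromBlocks s b 0 1, ?_⟩
    rw [hg', hS, transpose_mul]
    simp only [Matrix.mul_assoc]
    rw [← Matrix.mul_assoc (fromBlocks 1 0 0 S)ᵀ]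
    simp [fromBlocks_multiply, fromBlocks_transpose]

end SymmetricMatrices

/-! ### Order estimates and the formal inverse function theorem. -/

section Automorphisms

open MvPowerSeries Finsupp

variable {σ V : Type*} [CommRing V]

theorem le_order_add {k : ℕ∞} {p q : MvPowerSeries σ V} (hp : k ≤ p.order) (hq : k ≤ q.order) :
    k ≤ (p + q).order :=
  (le_min hp hq).trans min_order_le_add

theorem le_order_sub {k : ℕ∞} {p q : MvPowerSeries σ V} (hp : k ≤ p.order) (hq : k ≤ q.order) :
    k ≤ (p - q).order := by
  rw [sub_eq_add_neg]
  exact le_order_add hp (by rwa [order_neg])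

theorem le_order_sum {ι : Type*} (s : Finset ι) {k : ℕ∞} {p : ι → MvPowerSeries σ V}
    (hp : ∀ i ∈ s, k ≤ (p i).order) : k ≤ (∑ i ∈ s, p i).order :=
  Finset.sum_induction p (fun q => k ≤ q.order) (fun _ _ => le_order_add) (by simp) hp

theorem eq_zero_of_forall_le_order {p : MvPowerSeries σ V} (hp : ∀ k : ℕ, (k : ℕ∞) ≤ p.order) :
    p = 0 := by
  rw [← order_eq_top_iff]
  exact ENat.eq_top_iff_forall_ge.mpr hp

/-- An additive endomorphism that is the identity up to terms of higher order is bijective. -/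
theorem bijective_of_le_order_sub (φ : MvPowerSeries σ V →+ MvPowerSeries σ V)
    (hφ : ∀ (k : ℕ) (p : MvPowerSeries σ V), (k : ℕ∞) ≤ p.order →
      ((k + 1 : ℕ) : ℕ∞) ≤ (p - φ p).order) : Function.Bijective φ := by
  constructor
  · rw [injective_iff_map_eq_zero]
    intro p hp
    refine eq_zero_of_forall_le_order fun k => ?_
    induction k with
    | zero => simp
    | succ k ih => simpa [hp] using hφ k p ih
  · intro q
    -- Neumann series: the preimage of q is ∑ (1 - φ)^k q. The k-th term has order at least k, so
    -- the coefficient at `d` needs only the terms with k ≤ deg d.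
    let T : ℕ → MvPowerSeries σ V := fun k => (fun p => p - φ p)^[k] q
    have hT1 : ∀ k, T (k + 1) = T k - φ (T k) := fun k => Function.iterate_succ_apply' _ _ _
    have hT : ∀ k : ℕ, (k : ℕ∞) ≤ (T k).order := by
      intro k
      induction k with
      | zero => simp
      | succ k ih => rw [hT1]; exact hφ k _ ih
    let p : MvPowerSeries σ V := fun d => ∑ k ∈ Finset.range (degree d + 1), coeff d (T k)
    have hp : ∀ n : ℕ, (n : ℕ∞) ≤ (p - ∑ k ∈ Finset.range n, T k).order := by
      intro n
      refine nat_le_order fun d hd => ?_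
      rw [map_sub, map_sum, sub_eq_zero]
      refine Finset.sum_subset (Finset.range_subset_range.mpr hd) fun k _ hk => ?_
      refine coeff_of_lt_order (lt_of_lt_of_le ?_ (hT k))
      rw [Finset.mem_range, not_lt] at hk
      exact_mod_cast hk
    have hS : ∀ n, φ (∑ k ∈ Finset.range n, T k) = q - T n := by
      intro n
      have : ∀ k, φ (T k) = T k - T (k + 1) := fun k => by rw [hT1, sub_sub_cancel]
      rw [map_sum, Finset.sum_congr rfl fun k _ => this k, Finset.sum_range_sub']
      rfl
    refine ⟨p, sub_eq_zero.mp (eq_zero_of_forall_le_order fun n => ?_)⟩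
    have e : φ p - q = (p - ∑ k ∈ Finset.range n, T k) - ((p - ∑ k ∈ Finset.range n, T k) -
        φ (p - ∑ k ∈ Finset.range n, T k)) - T n := by
      rw [map_sub, hS]
      abel
    rw [e]
    refine le_order_sub (le_order_sub (hp n) ?_) (hT n)
    exact le_trans (by exact_mod_cast n.le_succ) (hφ n _ (hp n))

theorem two_le_order {p : MvPowerSeries σ V} (h0 : constantCoeff p = 0)
    (h1 : ∀ s, coeff (single s 1) p = 0) : 2 ≤ p.order := by
  refine nat_le_order (n := 2) fun d hd => ?_
  by_cases hd0 : degree d = 0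
  · rw [degree_eq_zero_iff] at hd0
    rw [hd0]
    exact h0
  · have hd1 : d.support.Nonempty := by
      rw [support_nonempty_iff]
      exact (degree_eq_zero_iff d).not.mp hd0
    obtain ⟨s, hs⟩ := hd1
    obtain ⟨e, rfl⟩ := exists_add_of_le
      (single_le_iff.mpr (Nat.one_le_iff_ne_zero.mpr (mem_support_iff.mp hs)))
    rw [map_add, degree_single] at hd
    rw [(degree_eq_zero_iff e).mp (by omega), add_zero]
    exact h1 s

variable [Fintype σ]

theorem sum_smul_sum_smul {M : Type*} [AddCommMonoid M] [Module V M] (A B : Matrix σ σ V)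
    (x : σ → M) (i : σ) : ∑ j, A i j • ∑ k, B j k • x k = ∑ k, (A * B) i k • x k := by
  simp only [Matrix.mul_apply, Finset.sum_smul, Finset.smul_sum, mul_smul]
  exact Finset.sum_comm

variable [DecidableEq σ]

theorem le_order_sub_subst {w : σ → MvPowerSeries σ V} (hw0 : ∀ s, constantCoeff (w s) = 0)
    (hw1 : linearPart w = 1) (k : ℕ) : ∀ p : MvPowerSeries σ V, (k : ℕ∞) ≤ p.order →
      ((k + 1 : ℕ) : ℕ∞) ≤ (p - subst w p).order := by
  have hs := hasSubst_of_constantCoeff_zero hw0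
  induction k with
  | zero =>
    intro p _
    rw [zero_add, Nat.cast_one, one_le_order_iff_constCoeff_eq_zero]
    have := constantCoeff_subst_eq_zero hs hw0 (f := p - C (constantCoeff p)) (by simp)
    rw [subst_sub hs, map_sub, sub_eq_zero, subst_C, constantCoeff_C] at this
    rw [map_sub, this, sub_self]
  | succ k ih =>
    intro p hp
    have hp0 : constantCoeff p = 0 := by
      rw [← one_le_order_iff_constCoeff_eq_zero]
      exact le_trans (by exact_mod_cast Nat.le_add_left 1 k) hp
    obtain ⟨q, hq, hqc⟩ := exists_eq_sum_X_mul hp0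
    have hqo : ∀ s, (k : ℕ∞) ≤ (q s).order := by
      refine fun s => nat_le_order fun d hd => by_contra fun hne => hqc s d hne ?_
      refine coeff_of_lt_order (lt_of_lt_of_le ?_ hp)
      rw [map_add, degree_single]
      exact_mod_cast Nat.succ_lt_succ hd
    have e : p - subst w p = ∑ s, ((X s - w s) * q s + w s * (q s - subst w (q s))) := by
      have : subst w p = ∑ s, w s * subst w (q s) := by
        conv_lhs => rw [hq]
        rw [← coe_substAlgHom hs, map_sum]
        simp only [map_mul, substAlgHom_X]
      rw [this]
      nth_rewrite 1 [hq]
      rw [← Finset.sum_sub_distrib]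
      exact Finset.sum_congr rfl fun s _ => by ring
    rw [e]
    refine le_order_sum _ fun s _ => le_order_add ?_ ?_
    · refine le_trans ?_ le_order_mul
      have h2 : 2 ≤ (X s - w s : MvPowerSeries σ V).order := by
        refine two_le_order (by simp [hw0]) fun t => ?_
        have : coeff (single t 1) (w s) = (1 : Matrix σ σ V) s t := by rw [← hw1]; rfl
        rw [map_sub, this, coeff_single_X, Matrix.one_apply, sub_self]
      refine le_trans (le_of_eq ?_) (add_le_add h2 (hqo s))
      push_cast
      ring
    · refine le_trans ?_ le_order_mul
      have h1 : 1 ≤ (w s).order := one_le_order_iff_constCoeff_eq_zero.mpr (hw0 s)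
      refine le_trans (le_of_eq ?_) (add_le_add h1 (ih _ (hqo s)))
      push_cast
      ring

/-- The inverse function theorem for formal power series. -/
theorem exists_algEquiv_X {w : σ → MvPowerSeries σ V} (hw0 : ∀ s, constantCoeff (w s) = 0)
    (hw1 : IsUnit (linearPart w).det) :
    ∃ ψ : MvPowerSeries σ V ≃ₐ[V] MvPowerSeries σ V, ∀ s, ψ (X s) = w s := by
  let L : Matrix σ σ V → σ → MvPowerSeries σ V := fun A i => ∑ j, A i j • X j
  have hL : ∀ A, HasSubst (L A) := fun A => hasSubst_of_constantCoeff_zero fun i => by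
    simp [L, smul_eq_C_mul]
  have hLL : ∀ A B : Matrix σ σ V, A * B = 1 →
      (substAlgHom (R := V) (hL B)).comp (substAlgHom (hL A)) = AlgHom.id V _ := by
    intro A B hAB
    ext1 p
    have : (fun s => subst (L B) (L A s)) = X := by
      funext i
      rw [← coe_substAlgHom (hL B), map_sum]
      simp only [map_smul, substAlgHom_X]
      rw [sum_smul_sum_smul, hAB]
      simp [Matrix.one_apply, ite_smul]
    simp only [AlgHom.comp_apply, coe_substAlgHom, AlgHom.id_apply]
    rw [subst_comp_subst_apply (hL A) (hL B), this, subst_self, id]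
  let T := linearPart w
  let ψ₂ : MvPowerSeries σ V ≃ₐ[V] MvPowerSeries σ V :=
    AlgEquiv.ofAlgHom (substAlgHom (hL T)) (substAlgHom (hL T⁻¹))
      (hLL _ _ (Matrix.nonsing_inv_mul _ hw1)) (hLL _ _ (Matrix.mul_nonsing_inv _ hw1))
  -- Normalizing the linear part to the identity splits the substitution into an invertible linear
  -- one and one tangent to the identity.
  let v : σ → MvPowerSeries σ V := fun i => ∑ j, T⁻¹ i j • w j
  have hv0 : ∀ s, constantCoeff (v s) = 0 := fun s => by
    simp [v, smul_eq_C_mul, hw0]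
  have hv1 : linearPart v = 1 := by
    rw [← Matrix.nonsing_inv_mul _ hw1]
    ext i j
    simp [linearPart, v, Matrix.mul_apply, T]
  have hv := hasSubst_of_constantCoeff_zero hv0
  have hbij : Function.Bijective (substAlgHom (R := V) hv) :=
    bijective_of_le_order_sub (AddMonoidHomClass.toAddMonoidHom (substAlgHom (R := V) hv))
      fun k p hp => by
        rw [AddMonoidHom.coe_coe, coe_substAlgHom]
        exact le_order_sub_subst hv0 hv1 k p hp
  let ψ₁ : MvPowerSeries σ V ≃ₐ[V] MvPowerSeries σ V := AlgEquiv.ofBijective _ hbij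
  refine ⟨ψ₂.trans ψ₁, fun s => ?_⟩
  have h2 : ψ₂ (X s) = ∑ j, T s j • X j := substAlgHom_X (hL T) s
  have h1 : ∀ s, ψ₁ (X s) = v s := substAlgHom_X hv
  rw [AlgEquiv.trans_apply, h2, map_sum]
  simp only [map_smul, h1, v]
  rw [sum_smul_sum_smul, Matrix.mul_nonsing_inv _ hw1]
  simp [Matrix.one_apply, ite_smul]

end Automorphisms

/-! ### The formal Morse lemma. -/

section Morse

open MvPowerSeries

/-- The Morse lemma for a nondegenerate formal power series. -/
theorem exists_algEquiv_sum_sq {σ : Type*} [Fintype σ] [DecidableEq σ] {V : Type*} [CommRing V]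
    [IsLocalRing V] [Invertible (2 : V)] (hV : ∀ u : V, IsUnit u → IsSquare u)
    {F : MvPowerSeries σ V} (h0 : constantCoeff F = 0)
    (h1 : ∀ s, coeff (Finsupp.single s 1) F = 0) (hF : IsUnit (hessian F).det) :
    RightEquiv F (∑ s, X s ^ 2) := by
  obtain ⟨A, hA, hFA, hA0⟩ := exists_eq_quadratic h0 h1
  have h2 : IsUnit (2 : MvPowerSeries σ V) := by
    rw [show (2 : MvPowerSeries σ V) = C 2 from (map_ofNat C 2).symm]
    exact (isUnit_of_invertible (2 : V)).map C
  have hAdet : IsUnit A.det := by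
    rw [isUnit_iff_constantCoeff, RingHom.map_det]
    have : constantCoeff.mapMatrix A = (⅟2 : V) • hessian F := hA0
    rw [this, Matrix.det_smul]
    exact ((isUnit_of_invertible _).pow _).mul hF
  obtain ⟨S, hS⟩ := exists_transpose_mul_self h2 (fun u hu => isSquare_of_isUnit hV hu) _ rfl A hA
    hAdet
  let w : σ → MvPowerSeries σ V := fun s => ∑ j, X j * S s j
  have hw0 : ∀ s, constantCoeff (w s) = 0 := fun s => by simp [w]
  have hw1 : IsUnit (linearPart w).det := by
    have : linearPart w = constantCoeff.mapMatrix S := by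
      ext i j
      exact coeff_single_sum_X_mul _ _
    rw [this, ← RingHom.map_det]
    refine IsUnit.map _ ?_
    rw [hS, Matrix.det_mul] at hAdet
    exact isUnit_of_mul_isUnit_right hAdet
  obtain ⟨ψ, hψ⟩ := exists_algEquiv_X hw0 hw1
  refine ⟨ψ.symm, ?_⟩
  rw [AlgEquiv.symm_apply_eq, map_sum, hFA]
  simp only [map_mul, hψ, w, hS, Matrix.mul_apply, Matrix.transpose_apply, pow_two,
    Finset.mul_sum, Finset.sum_mul]
  rw [Finset.sum_comm]
  conv_rhs => rw [Finset.sum_comm]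
  refine Finset.sum_congr rfl fun j _ => ?_
  conv_rhs => rw [Finset.sum_comm]
  exact Finset.sum_congr rfl fun i _ => Finset.sum_congr rfl fun k _ => by ring

end Morse

open MvPowerSeries IsLocalRing

/-! ### Maximal and gradient ideals, and invariance of nondegeneracy. -/

section MaximalIdeal

variable {σ V : Type*} [CommRing V]

theorem RightEquiv.contactEquiv {F G : MvPowerSeries σ V} (h : RightEquiv F G) :
    ContactEquiv F G := by
  obtain ⟨φ, rfl⟩ := h
  refine ⟨Ideal.quotientEquivAlg _ _ φ ?_⟩
  rw [Ideal.map_span, Set.image_singleton]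
  rfl

theorem ker_constantCoeff [Fintype σ] :
    RingHom.ker (constantCoeff (σ := σ) (R := V)) = Ideal.span (Set.range X) := by
  apply le_antisymm
  · intro p hp
    obtain ⟨q, rfl, -⟩ := exists_eq_sum_X_mul hp
    exact Ideal.sum_mem _ fun s _ =>
      Ideal.mul_mem_right _ _ (Ideal.subset_span ⟨s, rfl⟩)
  · rw [Ideal.span_le]
    rintro _ ⟨s, rfl⟩
    simp

/-- The gradient ideal at a nondegenerate critical point is generated by the variables. -/
theorem jacobianIdeal_eq_ker [Fintype σ] [DecidableEq σ] {F : MvPowerSeries σ V}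
    (h1 : ∀ s, coeff (Finsupp.single s 1) F = 0) (hF : IsUnit (hessian F).det) :
    jacobianIdeal F = RingHom.ker (constantCoeff (σ := σ) (R := V)) := by
  have h0 : ∀ i, constantCoeff (pderiv V i F) = 0 := fun i => by rw [constantCoeff_pderiv, h1]
  apply le_antisymm
  · rw [jacobianIdeal, Ideal.span_le]
    rintro _ ⟨i, rfl⟩
    exact h0 i
  · choose q hq _ using fun i => exists_eq_sum_X_mul (h0 i)
    -- The gradient is `Q` times the vector of variables and Q(0) is the Hessian, so `Q` can be
    -- inverted.
    let Q : Matrix σ σ (MvPowerSeries σ V) := Matrix.of q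
    have hQ : IsUnit Q.det := by
      rw [isUnit_iff_constantCoeff, RingHom.map_det]
      convert hF
      ext i j
      rw [hessian_apply, hq, coeff_single_sum_X_mul]
      rfl
    have hX : (fun s => (X s : MvPowerSeries σ V)) = Q⁻¹.mulVec (fun i => pderiv V i F) := by
      have : (fun i => pderiv V i F) = Q.mulVec fun s => X s := by
        funext i
        rw [hq, Matrix.mulVec, dotProduct]
        exact Finset.sum_congr rfl fun s _ => mul_comm _ _
      rw [this, Matrix.mulVec_mulVec, Matrix.nonsing_inv_mul _ hQ, Matrix.one_mulVec]
    rw [ker_constantCoeff, Ideal.span_le]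
    rintro _ ⟨s, rfl⟩
    rw [congrFun hX s]
    exact Ideal.sum_mem _ fun i _ => Ideal.mul_mem_left _ _ (Ideal.subset_span ⟨i, rfl⟩)

variable [IsLocalRing V]

theorem mem_maximalIdeal_iff {p : MvPowerSeries σ V} :
    p ∈ maximalIdeal (MvPowerSeries σ V) ↔ constantCoeff p ∈ maximalIdeal V := by
  rw [mem_maximalIdeal, mem_maximalIdeal, mem_nonunits_iff, mem_nonunits_iff,
    isUnit_iff_constantCoeff]

theorem maximalIdeal_eq_sup {π : V} (hπ : maximalIdeal V = Ideal.span {π}) :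
    maximalIdeal (MvPowerSeries σ V) =
      RingHom.ker (constantCoeff (σ := σ) (R := V)) ⊔ Ideal.span {C π} := by
  apply le_antisymm
  · intro p hp
    rw [mem_maximalIdeal_iff, hπ, Ideal.mem_span_singleton'] at hp
    obtain ⟨c, hc⟩ := hp
    have : p = (p - C (constantCoeff p)) + C c * C π := by
      rw [← map_mul, hc, sub_add_cancel]
    rw [this]
    refine Submodule.add_mem_sup ?_ ?_
    · simp
    · exact Ideal.mul_mem_left _ _ (Ideal.mem_span_singleton_self _)
  · refine sup_le (fun p hp => ?_) ?_
    · rw [mem_maximalIdeal_iff, (RingHom.mem_ker).mp hp]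
      exact zero_mem _
    · rw [Ideal.span_singleton_le_iff_mem, mem_maximalIdeal_iff, constantCoeff_C, hπ]
      exact Ideal.mem_span_singleton_self _

/-- If `F` is contact equivalent to a sum of squares of all variables, it is nondegenerate. -/
theorem isUnit_det_hessian_of_contactEquiv [Fintype σ] [DecidableEq σ] (h2 : IsUnit (2 : V))
    {F : MvPowerSeries σ V} (h0 : constantCoeff F = 0)
    (h1 : ∀ s, coeff (Finsupp.single s 1) F = 0) (h : ContactEquiv F (∑ s, X s ^ 2)) :
    IsUnit (hessian F).det := by
  obtain ⟨θ⟩ := h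
  let G : MvPowerSeries σ V := ∑ s, X s ^ 2
  have hw : ∀ s, ∃ w, Ideal.Quotient.mk (Ideal.span {F}) w =
      θ.symm (Ideal.Quotient.mk (Ideal.span {G}) (X s)) := fun s => Ideal.Quotient.mk_surjective _
  choose w hw using hw
  have hw0 : ∀ s, constantCoeff (w s) ∈ maximalIdeal V := by
    intro s
    rw [← mem_maximalIdeal_iff, mem_maximalIdeal, mem_nonunits_iff]
    intro hu
    have h3 := (hu.map (Ideal.Quotient.mk (Ideal.span {F}))).map θ
    rw [hw, AlgEquiv.apply_symm_apply] at h3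
    obtain ⟨y, hy⟩ := h3.exists_right_inv
    obtain ⟨y, rfl⟩ := Ideal.Quotient.mk_surjective y
    rw [← map_mul, ← map_one (Ideal.Quotient.mk _), Ideal.Quotient.eq,
      Ideal.mem_span_singleton'] at hy
    obtain ⟨c, hc⟩ := hy
    have := congrArg constantCoeff hc
    simp [G] at this
  have hwlin : IsUnit (linearPart w).det := by
    refine isUnit_det_linearPart w hw0 fun s => ?_
    obtain ⟨x, hx⟩ := Ideal.Quotient.mk_surjective (θ (Ideal.Quotient.mk (Ideal.span {F}) (X s)))
    obtain ⟨g, hg, -⟩ := exists_eq_sum_X_mul (p := x - C (constantCoeff x)) (by simp)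
    choose c hc using fun i => Ideal.Quotient.mk_surjective
      (θ.symm (Ideal.Quotient.mk (Ideal.span {G}) (g i)))
    -- Expand a lift of θ(X_s) in the variables and pull back; `V`-linearity keeps its constant term
    -- constant, and F contributes no linear terms.
    have key : X s - (∑ i, c i * w i + C (constantCoeff x)) ∈ Ideal.span {F} := by
      rw [← Ideal.Quotient.eq, map_add, map_sum]
      simp only [map_mul, hc, hw]
      rw [← θ.symm_apply_apply (Ideal.Quotient.mk _ (X s)), ← hx]
      have e : x = ∑ i, g i * X i + C (constantCoeff x) := by
        simp only [mul_comm (g _)]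
        rw [← hg, sub_add_cancel]
      nth_rewrite 1 [e]
      rw [map_add, map_add, map_sum, map_sum]
      simp only [map_mul]
      congr 1
      exact θ.symm.commutes _
    obtain ⟨b, hb⟩ := Ideal.mem_span_singleton'.mp key
    refine ⟨c, C (constantCoeff x) + b * F, ?_, fun j => ?_⟩
    · rw [hb]; ring
    · rw [map_add, coeff_single_mul, h0, h1, coeff_C, if_neg (by simp)]
      simp
  have hsq : ∑ s, w s ^ 2 ∈ Ideal.span {F} := by
    rw [← Ideal.Quotient.eq_zero_iff_mem, map_sum]
    simp only [map_pow, hw]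
    rw [← map_zero θ.symm, ← Ideal.Quotient.eq_zero_iff_mem.mpr (Ideal.mem_span_singleton_self G)]
    simp only [G, map_sum, map_pow]
  obtain ⟨b, hb⟩ := Ideal.mem_span_singleton'.mp hsq
  -- Over the residue field ∑ w_s² has Hessian 2WᵀW, where W is the linear part of w; it also equals
  -- b(0) times the Hessian of F.
  have hmap : (hessian (b * F)).map (residue V) =
      residue V 2 • (((linearPart w).transpose * linearPart w).map (residue V)) := by
    ext i j
    have hw' : ∀ s, residue V (constantCoeff (w s)) = 0 := fun s =>
      (residue_eq_zero_iff _).mpr (hw0 s)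
    rw [hb, Matrix.map_apply, hessian_sum_sq]
    simp only [map_add, map_mul, map_sum, hw', zero_mul, Finset.sum_const_zero, mul_zero, add_zero,
      Matrix.smul_apply, Matrix.map_apply, smul_eq_mul]
  have hdet : IsUnit (hessian (b * F)).det := by
    rw [← isUnit_map_iff (residue V), RingHom.map_det, RingHom.mapMatrix_apply, hmap,
      Matrix.det_smul, ← RingHom.mapMatrix_apply, ← RingHom.map_det, Matrix.det_mul,
      Matrix.det_transpose]
    exact ((h2.map _).pow _).mul ((hwlin.mul hwlin).map _)
  rw [hessian_mul h0 h1, Matrix.det_smul] at hdet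
  exact isUnit_of_mul_isUnit_right hdet

end MaximalIdeal

/-! ### Reductions of principal ideals in a domain. -/

section Reductions

theorem isReduction_span_singleton_iff {A : Type*} [CommRing A] [IsDomain A] {p : A} (hp : p ≠ 0)
    {J : Ideal A} : IsReduction J (Ideal.span {p}) ↔ J = Ideal.span {p} := by
  constructor
  · rintro ⟨-, N, hN⟩
    rw [pow_succ', Ideal.span_singleton_pow, mul_comm, mul_comm (Ideal.span {p})] at hN
    exact (Ideal.span_singleton_mul_right_inj (pow_ne_zero N hp)).mp hN
  · rintro rfl
    exact ⟨le_rfl, 0, by simp⟩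

theorem isMinimalReduction_span_singleton_iff {A : Type*} [CommRing A] [IsDomain A] {p : A}
    (hp : p ≠ 0) {J : Ideal A} :
    IsMinimalReduction J (Ideal.span {p}) ↔ J = Ideal.span {p} := by
  rw [IsMinimalReduction, isReduction_span_singleton_iff hp]
  refine ⟨And.left, fun h => ⟨h, fun J₁ hJ₁ hred => ?_⟩⟩
  rw [isReduction_span_singleton_iff hp] at hred
  exact hJ₁.ne (hred.trans h.symm)

end Reductions

/-! ### Low-order coefficients of the lift. -/

section Tilde

variable {V : Type*} [CommRing V] {π : V} {n : ℕ}

theorem coeff_tilde (f : MvPowerSeries (Fin n) V) (e : Option (Fin n) →₀ ℕ) :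
    coeff e (tilde π f) = unitCoeff π (coeff e.some f) (e none) := rfl

theorem coeff_mem_of_mem_maximalIdeal_sq [IsLocalRing V]
    (hπ : maximalIdeal V = Ideal.span {π})
    {f : MvPowerSeries (Fin n) V} (hf : f ∈ maximalIdeal (MvPowerSeries (Fin n) V) ^ 2) :
    π ^ 2 ∣ constantCoeff f ∧
      ∀ i, π ∣ coeff (Finsupp.single i 1) f := by
  simp only [← Ideal.mem_span_singleton]
  rw [pow_two] at hf
  induction hf using Submodule.mul_induction_on' with
  | mem_mul_mem p hp q hq =>
    rw [mem_maximalIdeal_iff, hπ] at hp hq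
    refine ⟨?_, fun i => ?_⟩
    · rw [map_mul, pow_two, ← Ideal.span_singleton_mul_span_singleton]
      exact Ideal.mul_mem_mul hp hq
    · rw [coeff_single_mul]
      exact Ideal.add_mem _ (Ideal.mul_mem_right _ _ hp) (Ideal.mul_mem_left _ _ hq)
  | add p _ q _ hp hq =>
    exact ⟨by rw [map_add]; exact Ideal.add_mem _ hp.1 hq.1,
      fun i => by rw [map_add]; exact Ideal.add_mem _ (hp.2 i) (hq.2 i)⟩

variable [IsDomain V]

theorem unitCoeff_eq_zero (hπ : Irreducible π) {a : V} {m : ℕ} (h : π ^ (m + 1) ∣ a) :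
    unitCoeff π a m = 0 := by
  rw [unitCoeff, dif_neg]
  rintro ⟨u, rfl⟩
  rw [pow_succ', mul_dvd_mul_iff_right (pow_ne_zero m hπ.ne_zero)] at h
  exact hπ.not_isUnit (isUnit_of_dvd_unit h u.isUnit)

theorem unitCoeff_pow (hπ : Irreducible π) (m k : ℕ) :
    unitCoeff π (π ^ m) k = if k = m then 1 else 0 := by
  rw [unitCoeff]
  split_ifs with h hkm hkm
  · have := h.choose_spec
    subst hkm
    exact (mul_right_cancel₀ (pow_ne_zero k hπ.ne_zero) ((one_mul _).trans this)).symm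
  · obtain ⟨u, hu⟩ := h
    refine absurd (le_antisymm ?_ ?_) hkm
    · rw [← pow_dvd_pow_iff hπ.ne_zero hπ.not_isUnit, hu]
      exact dvd_mul_left _ _
    · rw [← pow_dvd_pow_iff hπ.ne_zero hπ.not_isUnit, ← Units.dvd_mul_left (u := u), hu]
  · exact absurd ⟨1, by simp [hkm]⟩ h
  · rfl

theorem eq_iff_none_some {e e' : Option (Fin n) →₀ ℕ} :
    e = e' ↔ e none = e' none ∧ e.some = e'.some := by
  refine ⟨by rintro rfl; exact ⟨rfl, rfl⟩, fun ⟨h0, h1⟩ => ?_⟩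
  ext (_ | i)
  · exact h0
  · exact DFunLike.congr_fun h1 i

theorem tilde_sum_sq (hπ : Irreducible π) :
    tilde π (C (π ^ 2) + ∑ i : Fin n, X i ^ 2) = ∑ s : Option (Fin n), X s ^ 2 := by
  ext e
  have hs : ∀ i j : Fin n, Finsupp.single i 2 = Finsupp.single j 2 ↔ i = j := fun i j =>
    (Finsupp.single_left_injective two_ne_zero).eq_iff
  rw [coeff_tilde, Fintype.sum_option]
  simp only [map_add, map_sum, coeff_X_pow, coeff_C, eq_iff_none_some (e := e),
    Finsupp.some_single_none, Finsupp.some_single_some, Finsupp.single_eq_same,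
    Finsupp.single_apply, reduceCtorEq, if_false]
  by_cases h : ∃ i, e.some = Finsupp.single i 2
  · obtain ⟨i, hi⟩ := h
    have := unitCoeff_pow hπ 0 (e none)
    rw [pow_zero] at this
    simp [hi, hs, this, Finset.sum_ite_eq, and_comm, ite_and]
  · have h' : ∀ i, e.some ≠ Finsupp.single i 2 := fun i hi => h ⟨i, hi⟩
    by_cases h0 : e.some = 0
    · have h0' : ∀ i : Fin n, ¬ (0 : Fin n →₀ ℕ) = Finsupp.single i 2 := fun i => h0 ▸ h' i
      simp [h0, h0', unitCoeff_pow hπ]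
    · simp [h', h0, unitCoeff_eq_zero hπ]

theorem constantCoeff_tilde (hπ : Irreducible π) {f : MvPowerSeries (Fin n) V}
    (hf : π ^ 2 ∣ constantCoeff f) : constantCoeff (tilde π f) = 0 := by
  rw [← coeff_zero_eq_constantCoeff_apply, coeff_tilde, Finsupp.some_zero]
  exact unitCoeff_eq_zero hπ ((pow_dvd_pow π one_le_two).trans hf)

/-- A term y would need a constant term of valuation 1, and a term x_i a unit linear coefficient. -/
theorem coeff_single_tilde (hπ : Irreducible π) {f : MvPowerSeries (Fin n) V}
    (hf : π ^ 2 ∣ constantCoeff f) (hf1 : ∀ i, π ∣ coeff (Finsupp.single i 1) f)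
    (s : Option (Fin n)) : coeff (Finsupp.single s 1) (tilde π f) = 0 := by
  rw [coeff_tilde]
  cases s with
  | none =>
    rw [Finsupp.some_single_none, Finsupp.single_eq_same]
    exact unitCoeff_eq_zero hπ hf
  | some i =>
    rw [Finsupp.some_single_some, Finsupp.single_eq_of_ne (by simp)]
    exact unitCoeff_eq_zero hπ (by simpa using hf1 i)

end Tilde

/-! ### Full rank. -/

section Rank

variable {V : Type*} [CommRing V] {π : V} {n : ℕ}

theorem residualIdeal_le_ker (r : ℕ) :
    residualIdeal n π r ≤ RingHom.ker (constantCoeff (σ := Option (Fin n)) (R := V)) := by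
  rw [residualIdeal, ker_constantCoeff]
  refine Finset.sum_induction _ (fun I => I ≤ _) (fun _ _ => sup_le) bot_le fun i hi => ?_
  have : r - i ≠ 0 := by
    rw [Finset.mem_range] at hi
    omega
  exact Ideal.mul_le_right.trans (Ideal.pow_le_self this)

/-- At k = n no variable is left for `g`, so it is constant, and 𝔞₃ has no nonzero constants. -/
theorem hasRank_self_iff {f : MvPowerSeries (Fin n) V} :
    HasRank π f n ↔ RightEquiv (tilde π f) (∑ s, X s ^ 2) := by
  have hsum : (X none : PowXY n V) ^ 2 +
      ∑ i ∈ Finset.univ.filter (fun i : Fin n => (i : ℕ) < n), (X (some i) : PowXY n V) ^ 2 =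
      ∑ s, X s ^ 2 := by
    rw [Fintype.sum_option, Finset.filter_true_of_mem fun i _ => i.isLt]
  constructor
  · rintro ⟨-, g, hg, hgv, h⟩
    have : g = 0 := by
      ext e
      by_contra hne
      have he := hgv e hne
      have he0 : e = 0 := by
        ext s
        cases s with
        | none => exact he.1
        | some i => exact he.2 i i.isLt
      rw [he0] at hne
      exact hne (residualIdeal_le_ker _ hg)
    rwa [hsum, this, add_zero] at h
  · intro h
    refine ⟨le_rfl, 0, zero_mem _, fun e he => absurd (map_zero _) he, ?_⟩
    rwa [hsum, add_zero]

end Rank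

/-! ### Tjurina number one and nondegeneracy. -/

section Tjurina

variable {V : Type*} [CommRing V] [IsDomain V] [IsDiscreteValuationRing V] {π : V} {n : ℕ}
  {f : MvPowerSeries (Fin n) V}

theorem isUnit_det_hessian_of_isTjurinaNumber_one (hπ : Irreducible π)
    (h0 : constantCoeff (tilde π f) = 0)
    (h1 : ∀ s, coeff (Finsupp.single s 1) (tilde π f) = 0) (h : IsTjurinaNumber π f 1) :
    IsUnit (hessian (tilde π f)).det := by
  obtain ⟨-, a, -, ha⟩ | ⟨-, h⟩ := h
  swap
  · exact absurd h (by simp)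
  have hmax : (tjurinaIdeal π f ⊔ Ideal.span {a}).IsMaximal := by
    rw [Ideal.isMaximal_def, ← isSimpleModule_iff_isCoatom]
    exact Module.length_eq_one_iff.mp ha.symm
  replace hmax := eq_maximalIdeal hmax
  have hm : ∀ p : PowXY n V, constantCoeff p ∈ maximalIdeal V → ∃ (c : Option (Fin n) → PowXY n V)
      (b d : PowXY n V), p = ∑ s, c s * pderiv V s (tilde π f) + (b * tilde π f + d * a) := by
    intro p hp
    rw [← mem_maximalIdeal_iff, ← hmax, tjurinaIdeal, jacobianIdeal] at hp
    obtain ⟨y, hy, z, hz, rfl⟩ := Submodule.mem_sup.mp hp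
    obtain ⟨u, hu, v, hv, rfl⟩ := Submodule.mem_sup.mp hy
    obtain ⟨b, rfl⟩ := Ideal.mem_span_singleton'.mp hu
    obtain ⟨d, rfl⟩ := Ideal.mem_span_singleton'.mp hz
    obtain ⟨c, rfl⟩ := Ideal.mem_span_range_iff_exists_fun.mp hv
    exact ⟨c, b, d, by ring⟩
  have ha0 : constantCoeff a ∈ maximalIdeal V := by
    rw [← mem_maximalIdeal_iff, ← hmax]
    exact Ideal.mem_sup_right (Ideal.mem_span_singleton_self a)
  have hJ0 : ∀ s, constantCoeff (pderiv V s (tilde π f)) = 0 := fun s => by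
    rw [constantCoeff_pderiv, h1]
  -- Otherwise all generators of the maximal ideal would vanish at the origin, while π does not.
  have hane : constantCoeff a ≠ 0 := by
    intro hz
    obtain ⟨c, b, d, e⟩ := hm (C π) (by
      rw [constantCoeff_C, hπ.maximalIdeal_eq]
      exact Ideal.mem_span_singleton_self π)
    have := congrArg constantCoeff e
    simp only [map_add, map_sum, map_mul, hJ0, h0, hz, constantCoeff_C, mul_zero, add_zero,
      Finset.sum_const_zero] at this
    exact hπ.ne_zero this
  refine isUnit_det_linearPart _ (fun s => by rw [hJ0]; exact zero_mem _) fun s => ?_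
  obtain ⟨c, b, d, e⟩ := hm (X s) (by simp)
  refine ⟨c, _, e, fun j => ?_⟩
  have := congrArg constantCoeff e
  simp only [map_add, map_sum, map_mul, hJ0, h0, constantCoeff_X, mul_zero, zero_add,
    Finset.sum_const_zero] at this
  -- Hence the linear terms of `d * a` are multiples of a(0), so they vanish in the residue field.
  have hd0 : constantCoeff d = 0 := (mul_eq_zero.mp this.symm).resolve_right hane
  rw [map_add, coeff_single_mul, coeff_single_mul, h0, h1, hd0]
  simpa using Ideal.mul_mem_left _ _ ha0

theorem isTjurinaNumber_iff_eq_one (hπ : Irreducible π) (h0 : constantCoeff (tilde π f) = 0)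
    (h1 : ∀ s, coeff (Finsupp.single s 1) (tilde π f) = 0)
    (hF : IsUnit (hessian (tilde π f)).det) (t : ℕ∞) : IsTjurinaNumber π f t ↔ t = 1 := by
  have hT : tjurinaIdeal π f = RingHom.ker (constantCoeff (σ := Option (Fin n)) (R := V)) := by
    rw [tjurinaIdeal, jacobianIdeal_eq_ker h1 hF, sup_eq_right, Ideal.span_singleton_le_iff_mem]
    exact h0
  have hprime : (tjurinaIdeal π f).IsPrime := hT ▸ RingHom.ker_isPrime _
  have hdim : ringKrullDim (PowXY n V ⧸ tjurinaIdeal π f) = 1 := by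
    rw [hT, ringKrullDim_eq_of_ringEquiv (RingHom.quotientKerEquivOfSurjective
      (f := constantCoeff (σ := Option (Fin n)) (R := V)) fun v => ⟨C v, constantCoeff_C v⟩)]
    exact IsDiscreteValuationRing.ringKrullDim_eq_one V
  have hmap : (maximalIdeal (PowXY n V)).map (Ideal.Quotient.mk (tjurinaIdeal π f)) =
      Ideal.span {Ideal.Quotient.mk (tjurinaIdeal π f) (C π)} := by
    rw [maximalIdeal_eq_sup hπ.maximalIdeal_eq, ← hT, Ideal.map_sup, Ideal.map_quotient_self,
      bot_sup_eq, Ideal.map_span, Set.image_singleton]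
  have hne : Ideal.Quotient.mk (tjurinaIdeal π f) (C π) ≠ 0 := by
    rw [Ne, Ideal.Quotient.eq_zero_iff_mem, hT, RingHom.mem_ker, constantCoeff_C]
    exact hπ.ne_zero
  have hadm : ∀ a, IsAdmissibleCut π f a ↔ Ideal.span {Ideal.Quotient.mk (tjurinaIdeal π f) a} =
      (maximalIdeal (PowXY n V)).map (Ideal.Quotient.mk (tjurinaIdeal π f)) := by
    intro a
    rw [IsAdmissibleCut, hmap, isMinimalReduction_span_singleton_iff hne]
  have hle : tjurinaIdeal π f ≤ maximalIdeal (PowXY n V) := by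
    rw [hT, maximalIdeal_eq_sup hπ.maximalIdeal_eq]
    exact le_sup_left
  have hlen : ∀ a, IsAdmissibleCut π f a →
      Module.length (PowXY n V) (PowXY n V ⧸ (tjurinaIdeal π f ⊔ Ideal.span {a})) = 1 := by
    intro a ha
    have : tjurinaIdeal π f ⊔ Ideal.span {a} = maximalIdeal (PowXY n V) := by
      have := congrArg (Ideal.comap (Ideal.Quotient.mk (tjurinaIdeal π f))) ((hadm a).mp ha)
      rw [← Set.image_singleton, ← Ideal.map_span,
        Ideal.comap_map_of_surjective' _ Ideal.Quotient.mk_surjective,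
        Ideal.comap_map_of_surjective' _ Ideal.Quotient.mk_surjective, Ideal.mk_ker,
        sup_eq_left.mpr hle] at this
      rw [sup_comm, this]
    rw [this, Module.length_eq_one_iff, isSimpleModule_iff_isCoatom, ← Ideal.isMaximal_def]
    infer_instance
  constructor
  · rintro (⟨-, a, ha, rfl⟩ | ⟨hd, -⟩)
    · exact hlen a ha
    · exact absurd hdim hd
  · rintro rfl
    -- The uniformizer is itself a cut, so existence holds as well.
    have ha : IsAdmissibleCut π f (C π) := (hadm _).mpr hmap.symm
    exact Or.inl ⟨hdim, C π, ha, (hlen _ ha).symm⟩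

end Tjurina

end MorseDVR

open MorseDVR in
theorem mainTheorem4 {V : Type*} [CommRing V] [IsDomain V] [IsDiscreteValuationRing V]
    [IsAdicComplete (IsLocalRing.maximalIdeal V) V]
    (hchar : ringChar (IsLocalRing.ResidueField V) ≠ 2)
    (hquad : ∀ c : IsLocalRing.ResidueField V, IsSquare c)
    (π : V) (hπ : Irreducible π) (n : ℕ)
    (f : MvPowerSeries (Fin n) V)
    (hf : f ∈ IsLocalRing.maximalIdeal (MvPowerSeries (Fin n) V) ^ 2) :
    List.TFAE
      [MorseDVR.IsTjurinaNumber π f 1,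
        ∀ t : ℕ∞, MorseDVR.IsTjurinaNumber π f t ↔ t = 1,
        MorseDVR.HasRank π f n,
        MorseDVR.Equivalent π f
          (MvPowerSeries.C (π ^ 2) + ∑ i : Fin n, MvPowerSeries.X i ^ 2)] := by
  have h2 : IsUnit (2 : V) := by
    rw [← isUnit_map_iff (IsLocalRing.residue V), map_ofNat]
    exact (Ring.two_ne_zero hchar).isUnit
  have : Invertible (2 : V) := h2.invertible
  have : HenselianLocalRing V :=
    { is_henselian := fun p hp a₀ h₁ h₃ =>
        HenselianRing.is_henselian p hp a₀ h₁ (h₃.map (Ideal.Quotient.mk _)) }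
  have hsq : ∀ u : V, IsUnit u → IsSquare u := fun u hu =>
    isSquare_of_isUnit_of_isSquare_residueField h2 hquad hu
  obtain ⟨hf0, hf1⟩ := coeff_mem_of_mem_maximalIdeal_sq hπ.maximalIdeal_eq hf
  have h0 := constantCoeff_tilde hπ hf0
  have h1 := coeff_single_tilde hπ hf0 hf1
  rw [hasRank_self_iff, Equivalent, tilde_sum_sq hπ]
  tfae_have 1 → 2 := fun h => isTjurinaNumber_iff_eq_one hπ h0 h1
    (isUnit_det_hessian_of_isTjurinaNumber_one hπ h0 h1 h)
  tfae_have 2 → 1 := fun h => (h 1).mpr rfl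
  tfae_have 1 → 3 := fun h => exists_algEquiv_sum_sq hsq h0 h1
    (isUnit_det_hessian_of_isTjurinaNumber_one hπ h0 h1 h)
  tfae_have 3 → 4 := RightEquiv.contactEquiv
  tfae_have 4 → 2 := fun h => isTjurinaNumber_iff_eq_one hπ h0 h1
    (isUnit_det_hessian_of_contactEquiv h2 h0 h1 h)
  tfae_finish
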